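/- Let $P$ be a smooth $N$-dimensional manifold with a general $n$-symplectic structure, that is, an $\mathbb R^n$-valued smooth 2-form $\hat\omega=\sum_\alpha\omega^\alpha\otimes\hat r_\alpha$ ($(\hat r_\alpha)$ the standard basis of $\mathbb R^n$) such that $d\omega^\alpha=0$ for all $\alpha$ and, for every tangent vector $X$, $X\lrcorner\,\omega^\alpha=0$ for all $\alpha$ if and only if $X=0$. Round brackets around indices denote symmetrization, $T^{(\alpha_1\dots\alpha_m)}=\frac1{m!}\sum_{\sigma\in S_m}T^{\alpha_{\sigma(1)}\dots\alpha_{\sigma(m)}}$. For $p\ge 1$ let $SHF^p$ be the real vector space of smooth functions $\hat f=(\hat f^{\alpha_1\dots\alpha_p})$ on $P$ with values in the symmetric tensors $\otimes_s^p\mathbb R^n$ for which there are smooth vector fields $X_{\hat f}^{\alpha_1\dots\alpha_{p-1}}$ on $P$ with $$d\hat f^{\alpha_1\dots\alpha_p}=-p!\,X_{\hat f}^{(\alpha_1\dots\alpha_{p-1}}\lrcorner\,\omega^{\alpha_p)},$$ and let $SHF=\bigoplus_{p\ge1}SHF^p$. Theorem. (i) For $\hat f\in SHF^p$ and $\hat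 g\in SHF^q$ the symmetrized tensor product $(\hat f\otimes_s\hat g)^{\alpha_1\dots\alpha_{p+q}}=\hat f^{(\alpha_1\dots\alpha_p}\hat g^{\alpha_{p+1}\dots\alpha_{p+q})}$ lies in $SHF^{p+q}$. (ii) For $\hat f\in SHF^p$ and $\hat g\in SHF^q$ the bracket $$\{\hat f,\hat g\}^{\alpha_1\dots\alpha_{p+q-1}}=p!\,X_{\hat f}^{(\alpha_1\dots\alpha_{p-1}}\bigl(\hat g^{\alpha_p\dots\alpha_{p+q-1})}\bigr)$$ does not depend on the choice of the vector fields $X_{\hat f}^{\alpha_1\dots\alpha_{p-1}}$ satisfying the above equation for $\hat f$, and lies in $SHF^{p+q-1}$. (iii) The operations $\otimes_s$ and $\{\ ,\ \}$ extend to $\mathbb R$-bilinear operations on $SHF$, and these make $SHF$ a (not necessarily unital) Poisson algebra: $(SHF,\otimes_s)$ is a commutative associative algebra, $(SHF,\{\ ,\ \})$ is a Lie algebra, and $\{\hat f,\hat g\otimes_s\hat h\}=\{\hat f,\hat g\}\otimes_s\hat h+\hat g\otimes_s\{\hat f,\hat h\}$ for all $\hat f,\hat g,\hat h\in SHF$.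 -/

import Mathlib

open scoped Manifold ContDiff

noncomputable section

namespace NSymplectic

/-- The set of multi-indices `α₁ … α_m` with entries in `{1, …, n}`. -/
abbrev MultiIndex (n m : ℕ) : Type := Fin m → Fin n

/-- Round brackets around indices: `T^{(α₁ … α_m)} = (1 / m!) ∑_σ T^{α_{σ 1} … α_{σ m}}`. -/
def symmetrize {V : Type*} [AddCommGroup V] [Module ℝ V] {n m : ℕ}
    (T : MultiIndex n m → V) (α : MultiIndex n m) : V :=
  ((m.factorial : ℝ)⁻¹) • ∑ σ : Equiv.Perm (Fin m), T (α ∘ σ)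

/-- The family `T^{α₁ … α_m}` is symmetric in its upper indices. -/
def IsSymm {V : Type*} {n m : ℕ} (T : MultiIndex n m → V) : Prop :=
  ∀ (σ : Equiv.Perm (Fin m)) (α : MultiIndex n m), T (α ∘ σ) = T α

section Manifold

variable {N : ℕ} {P : Type*} [TopologicalSpace P] [ChartedSpace (EuclideanSpace ℝ (Fin N)) P]

/-- The representation of a `k`-form `η` on `P` in the chart `φ` at `x₀`: the pullback of `η`
along `φ⁻¹`. It is meaningful on the (open) target of the chart. -/
def formInChart {k : ℕ} (η : (x : P) → (TangentSpace (𝓡 N) x) [⋀^Fin k]→L[ℝ] ℝ) (x₀ : P)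
    (y : EuclideanSpace ℝ (Fin N)) : (EuclideanSpace ℝ (Fin N)) [⋀^Fin k]→L[ℝ] ℝ :=
  (η ((extChartAt (𝓡 N) x₀).symm y)).compContinuousLinearMap
    (mfderiv 𝓘(ℝ, EuclideanSpace ℝ (Fin N)) (𝓡 N) (extChartAt (𝓡 N) x₀).symm y)

/-- A differential form on `P` is smooth if all its chart representations are. -/
def IsSmoothForm {k : ℕ} (η : (x : P) → (TangentSpace (𝓡 N) x) [⋀^Fin k]→L[ℝ] ℝ) : Prop :=
  ∀ x₀ : P, ContDiffOn ℝ ∞ (formInChart η x₀) (extChartAt (𝓡 N) x₀).target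

/-- A differential form on `P` is closed if the exterior derivative of each of its chart
representations vanishes. -/
def IsClosedForm {k : ℕ} (η : (x : P) → (TangentSpace (𝓡 N) x) [⋀^Fin k]→L[ℝ] ℝ) : Prop :=
  ∀ x₀ : P, ∀ y ∈ (extChartAt (𝓡 N) x₀).target, extDeriv (formInChart η x₀) y = 0

end Manifold

/-- A general `n`-symplectic (polysymplectic) structure on the `N`-dimensional manifold `P`: an
`ℝⁿ`-valued smooth 2-form `ω̂ = ω^α ⊗ r_α`, given by its components `ω^α`, that is closed and
non-degenerate. -/
structure GeneralNSymplecticStructure (N n : ℕ) (P : Type*) [TopologicalSpace P]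
    [ChartedSpace (EuclideanSpace ℝ (Fin N)) P] where
  /-- The components `ω^α`. -/
  form : Fin n → (x : P) → (TangentSpace (𝓡 N) x) [⋀^Fin 2]→L[ℝ] ℝ
  smooth : ∀ α, IsSmoothForm (form α)
  closed : ∀ α, IsClosedForm (form α)
  nondegenerate : ∀ (x : P) (v : TangentSpace (𝓡 N) x),
    (∀ (α : Fin n) (w : TangentSpace (𝓡 N) x), form α x ![v, w] = 0) ↔ v = 0

variable {N n : ℕ} {P : Type*} [TopologicalSpace P] [ChartedSpace (EuclideanSpace ℝ (Fin N)) P]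

variable (N n P) in
/-- Families `f^{α₁ … α_m}` of smooth real functions on `P`: the components, in the standard basis,
of smooth functions on `P` with values in the `m`-th tensor power of `ℝⁿ`. -/
abbrev TensorFunction (m : ℕ) : Type _ := MultiIndex n m → C^∞⟮𝓡 N, P; ℝ⟯

variable [IsManifold (𝓡 N) ∞ P]

variable (N n P) in
/-- Families `X^{α₁ … α_m}` of smooth vector fields on `P`. -/
abbrev TensorVectorField (m : ℕ) : Type _ :=
  MultiIndex n m →
    Cₛ^∞⟮𝓡 N; EuclideanSpace ℝ (Fin N), (TangentSpace (𝓡 N) : P → Type _)⟯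

/-- `X` is a set of Hamiltonian vector fields for the family `f` of rank `k + 1`:
`d f^{α₁ … α_{k+1}} = - (k+1)! X^{(α₁ … α_k} ⌟ ω^{α_{k+1})}`.
Only the symmetric part of `X` in its upper indices enters, so `X` need not be taken symmetric:
if `X` satisfies the equation, then so does its symmetrization. -/
def IsHamiltonianFor (Ω : GeneralNSymplecticStructure N n P) {k : ℕ}
    (f : TensorFunction N n P (k + 1)) (X : TensorVectorField N n P k) : Prop :=
  ∀ (α : MultiIndex n (k + 1)) (x : P) (w : TangentSpace (𝓡 N) x),
    mvfderiv (𝓡 N) (f α) x w =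
      -((k + 1).factorial : ℝ) *
        symmetrize (fun β : MultiIndex n (k + 1) =>
          Ω.form (β (Fin.last k)) x ![X (fun i => β i.castSucc) x, w]) α

theorem symmetrize_add_apply {n m : ℕ} (S T : MultiIndex n m → ℝ) (α : MultiIndex n m) :
    symmetrize S α + symmetrize T α = symmetrize (fun β => S β + T β) α := by
  simp [symmetrize, Finset.sum_add_distrib, mul_add]

theorem form_add_left {E : Type*} [AddCommGroup E] [Module ℝ E] [TopologicalSpace E]
    (η : E [⋀^Fin 2]→L[ℝ] ℝ) (u v w : E) : η ![u + v, w] = η ![u, w] + η ![v, w] := by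
  exact η.map_vecCons_add ![w] u v

theorem form_smul_left {E : Type*} [AddCommGroup E] [Module ℝ E] [TopologicalSpace E]
    (η : E [⋀^Fin 2]→L[ℝ] ℝ) (c : ℝ) (v w : E) : η ![c • v, w] = c * η ![v, w] := by
  exact η.map_vecCons_smul ![w] c v

theorem form_zero_left {E : Type*} [AddCommGroup E] [Module ℝ E] [TopologicalSpace E]
    (η : E [⋀^Fin 2]→L[ℝ] ℝ) (w : E) : η ![0, w] = 0 :=
  η.map_coord_zero 0 rfl

/-- The space of symmetric Hamiltonian functions of rank `k + 1`. Indexing by `k = rank - 1` builds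
in the restriction to ranks `≥ 1`. -/
def SHF (Ω : GeneralNSymplecticStructure N n P) (k : ℕ) :
    Submodule ℝ (TensorFunction N n P (k + 1)) where
  carrier := {f | IsSymm f ∧ ∃ X : TensorVectorField N n P k, IsHamiltonianFor Ω f X}
  add_mem' := by
    rintro f g ⟨hf, X, hfX⟩ ⟨hg, Y, hgY⟩
    refine ⟨fun σ α => by simp [hf σ α, hg σ α], X + Y, ?_⟩
    intro α x w
    have h : mvfderiv (𝓡 N) (⇑((f + g) α)) x =
        mvfderiv (𝓡 N) (f α) x + mvfderiv (𝓡 N) (g α) x :=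
      mvfderiv_add ((f α).contMDiff.mdifferentiable (by simp) x)
        ((g α).contMDiff.mdifferentiable (by simp) x)
    rw [h, add_apply, hfX, hgY, ← mul_add, symmetrize_add_apply]
    congr 2
    funext β
    exact (form_add_left _ _ _ _).symm
  zero_mem' := by
    refine ⟨fun σ α => rfl, 0, ?_⟩
    intro α x w
    have h : mvfderiv (𝓡 N) (⇑((0 : TensorFunction N n P (k + 1)) α)) x = 0 :=
      mvfderiv_zero
    rw [h, zero_apply]
    have h0 : (fun β : MultiIndex n (k + 1) => Ω.form (β (Fin.last k)) x
        ![(0 : TensorVectorField N n P k) (fun i => β i.castSucc) x, w]) = fun _ => 0 := by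
      funext β
      exact form_zero_left _ _
    rw [h0]
    simp [symmetrize]
  smul_mem' := by
    rintro c f ⟨hf, X, hfX⟩
    refine ⟨fun σ α => by simp [hf σ α], c • X, ?_⟩
    intro α x w
    have h : mvfderiv (𝓡 N) (⇑((c • f) α)) x = c • mvfderiv (𝓡 N) (f α) x := by
      have h1 := const_smul_mfderiv (I := 𝓡 N)
        ((f α).contMDiff.mdifferentiable (by simp) x) c
      ext v
      exact congrArg (fun L => L v) h1
    have h2 : (fun β : MultiIndex n (k + 1) => Ω.form (β (Fin.last k)) x
        ![(c • X) (fun i => β i.castSucc) x, w]) = fun β => c * Ω.form (β (Fin.last k)) x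
        ![X (fun i => β i.castSucc) x, w] := by
      funext β
      exact form_smul_left _ _ _ _
    rw [h, smul_apply, hfX, h2]
    simp only [symmetrize, smul_eq_mul, ← Finset.mul_sum]
    ring

/-- The symmetrized tensor product:
`(f ⊗ₛ g)^{α₁ … α_{p+q}} = f^{(α₁ … α_p} g^{α_{p+1} … α_{p+q})}`. -/
def symProduct {p q : ℕ} (f : TensorFunction N n P p) (g : TensorFunction N n P q) :
    TensorFunction N n P (p + q) :=
  symmetrize fun β : MultiIndex n (p + q) =>
    f (fun i => β (Fin.castAdd q i)) * g (fun j => β (Fin.natAdd p j))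

/-- The components of the bracket of `f` (of rank `k + 1`, with Hamiltonian vector fields `X`) and
`g` (of rank `l + 1`), at the point `x`:
`(k+1)! X^{(α₁ … α_k} (g^{α_{k+1} … α_{k+l+1})})`. -/
def bracketComponent {k l : ℕ} (X : TensorVectorField N n P k) (g : TensorFunction N n P (l + 1))
    (α : MultiIndex n (k + l + 1)) (x : P) : ℝ :=
  ((k + 1).factorial : ℝ) *
    symmetrize (fun β : MultiIndex n (k + (l + 1)) =>
      mvfderiv (𝓡 N) (g (fun j => β (Fin.natAdd k j))) x
        (X (fun i => β (Fin.castAdd (l + 1) i)) x)) α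

/-- `SHF`, the direct sum over all ranks `p = k + 1 ≥ 1` of the spaces of symmetric Hamiltonian
functions of rank `p`. -/
abbrev TotalSHF (Ω : GeneralNSymplecticStructure N n P) : Type _ :=
  DirectSum ℕ fun k => SHF Ω k

/-- A (not necessarily unital) real Poisson algebra: a commutative associative product together
with a Lie bracket that acts by derivations of the product. -/
structure IsPoissonAlgebra {A : Type*} [AddCommGroup A] [Module ℝ A]
    (mul br : A →ₗ[ℝ] A →ₗ[ℝ] A) : Prop where
  mul_comm : ∀ a b, mul a b = mul b a
  mul_assoc : ∀ a b c, mul (mul a b) c = mul a (mul b c)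
  bracket_self : ∀ a, br a a = 0
  bracket_antisymm : ∀ a b, br a b = -br b a
  jacobi : ∀ a b c, br a (br b c) + br b (br c a) + br c (br a b) = 0
  leibniz : ∀ a b c, br a (mul b c) = mul (br a b) c + mul b (br a c)

end NSymplectic

end

noncomputable section

namespace NSymplectic

/-! ### Hamiltonian vector fields of a closed 2-form on a normed space. -/

section VectorSpace

open VectorField Filter Topology

/-! A symmetric tensor is the same thing as a homogeneous polynomial. Contracting every index with a
covector `ξ` turns a symmetric family `f` of rank `k + 1` into one function `f_ξ`, and the `f_ξ`
together determine `f` (`IsSymm.eq_zero_of_contract`). The contraction does not see symmetrization,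
so the tensorial Hamiltonian equation becomes `d f_ξ = -X_ξ ⌟ ω_ξ` for all `ξ`, where `ω_ξ = ∑ ξ_γ
ω^γ` and `X_ξ` is `(k + 1)!` times the contraction of `X` (`isHamiltonianFor_iff`). Each `ω_ξ` is a
closed, possibly degenerate, scalar 2-form, `⊗ₛ` becomes the pointwise product, and the bracket
becomes `X_ξ(g_ξ)`.

What remains is classical. If `X`, `Y` are Hamiltonian for `f`, `g`, then `X(g) = ω_ξ(X, Y) =
-Y(f)`, which gives antisymmetry and independence of the choice of `X`. The field `gX + fY` is
Hamiltonian for `fg`, and `[X, Y]` is Hamiltonian for `X(g)` because `ω_ξ` is closed; this gives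
closure under both operations and the Jacobi identity. The Leibniz rule is that of a derivation.

On the direct sum the contractions of all ranks are added up. Nothing is lost: replacing `ξ` by `tξ`
multiplies the part of rank `p` by `t^p`, so the ranks separate as coefficients of a polynomial in
`t` (`total_ext`). Every identity may thus be checked after contraction, where any element of `SHF`
has a Hamiltonian field for `ω_ξ` (`exists_hamiltonianField_totalContract`). -/

theorem form_swap {E : Type*} [AddCommGroup E] [Module ℝ E] [TopologicalSpace E]
    (η : E [⋀^Fin 2]→L[ℝ] ℝ) (v w : E) : η ![v, w] = -η ![w, v] := by
  have h : η (![w, v] ∘ Equiv.swap 0 1) = -η ![w, v] :=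
    η.toAlternatingMap.map_swap ![w, v] (by simp)
  rw [← h]
  congr 1
  ext i
  fin_cases i <;> simp

theorem form_sub_left {E : Type*} [AddCommGroup E] [Module ℝ E] [TopologicalSpace E]
    (η : E [⋀^Fin 2]→L[ℝ] ℝ) (u v w : E) :
    η ![u - v, w] = η ![u, w] - η ![v, w] := by
  have h := form_add_left η (u - v) v w
  rw [sub_add_cancel] at h
  linarith

variable {E : Type*} [NormedAddCommGroup E] [NormedSpace ℝ E]

theorem fderiv_form_apply {ζ : E → E [⋀^Fin 2]→L[ℝ] ℝ} {X Y : E → E} {y : E}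
    (hζ : DifferentiableAt ℝ ζ y) (hX : DifferentiableAt ℝ X y) (hY : DifferentiableAt ℝ Y y)
    (u : E) :
    fderiv ℝ (fun z => ζ z ![X z, Y z]) y u = fderiv ℝ ζ y u ![X y, Y y] +
      ζ y ![fderiv ℝ X y u, Y y] + ζ y ![X y, fderiv ℝ Y y u] := by
  have hV : ∀ i, DifferentiableAt ℝ ((![X, Y] : Fin 2 → E → E) i) y := by
    intro i
    fin_cases i <;> assumption
  have h := fderiv_continuousAlternatingMap_apply_apply hζ hV u
  have e : ∀ z, (fun i => (![X, Y] : Fin 2 → E → E) i z) = ![X z, Y z] := by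
    intro z
    ext i
    fin_cases i <;> rfl
  simp only [e] at h
  rw [h, Fin.sum_univ_two, ← add_assoc]
  congr 3
  · ext i; fin_cases i <;> simp
  · ext i; fin_cases i <;> simp

theorem extDeriv_two_apply {ζ : E → E [⋀^Fin 2]→L[ℝ] ℝ} {y : E} (hζ : DifferentiableAt ℝ ζ y)
    (u v w : E) :
    extDeriv ζ y ![u, v, w] =
      fderiv ℝ ζ y u ![v, w] - fderiv ℝ ζ y v ![u, w] + fderiv ℝ ζ y w ![u, v] := by
  rw [extDeriv_apply hζ, Fin.sum_univ_three]
  have e0 : (0 : Fin 3).removeNth ![u, v, w] = ![v, w] := by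
    ext i; fin_cases i <;> rfl
  have e1 : (1 : Fin 3).removeNth ![u, v, w] = ![u, w] := by
    ext i; fin_cases i <;> rfl
  have e2 : (2 : Fin 3).removeNth ![u, v, w] = ![u, v] := by
    ext i; fin_cases i <;> rfl
  rw [e0, e1, e2]
  simp [fderiv_continuousAlternatingMap_apply_const_apply hζ]
  ring

/-- If `df = -X ⌟ ζ`, then `X ⌟ ζ` is closed. -/
theorem fderiv_contraction_symm {ζ : E → E [⋀^Fin 2]→L[ℝ] ℝ} {X : E → E} {f : E → ℝ} {y : E}
    (hζ : DifferentiableAt ℝ ζ y) (hX : DifferentiableAt ℝ X y) (hf : ContDiffAt ℝ 2 f y)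
    (h : ∀ᶠ z in 𝓝 y, ∀ w, fderiv ℝ f z w = -ζ z ![X z, w]) (u w : E) :
    fderiv ℝ ζ y u ![X y, w] + ζ y ![fderiv ℝ X y u, w] =
      fderiv ℝ ζ y w ![X y, u] + ζ y ![fderiv ℝ X y w, u] := by
  have key : ∀ a b : E, fderiv ℝ (fderiv ℝ f) y a b =
      -(fderiv ℝ ζ y a ![X y, b] + ζ y ![fderiv ℝ X y a, b]) := by
    intro a b
    have hd : DifferentiableAt ℝ (fderiv ℝ f) y :=
      (hf.fderiv_right (m := 1) (by norm_num)).differentiableAt (by norm_num)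
    have h1 : fderiv ℝ (fun z => fderiv ℝ f z b) y a = fderiv ℝ (fderiv ℝ f) y a b := by
      rw [fderiv_clm_apply hd (differentiableAt_const b)]
      simp
    rw [← h1, Filter.EventuallyEq.fderiv_eq (f := fun z => -ζ z ![X z, b])
      (h.mono fun z hz => hz b)]
    rw [fderiv_fun_neg, neg_apply,
      fderiv_form_apply hζ hX (differentiableAt_const b)]
    simp [form_swap (ζ y) (X y) 0, form_zero_left]
  -- By `key` the second derivative of `f` is minus the derivative of `X ⌟ ζ`; its symmetry is the
  -- claim.
  have hs := (hf.isSymmSndFDerivAt (by simp)) u w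
  rw [key, key] at hs
  linarith

/-- The bracket of two Hamiltonian vector fields of a closed form is Hamiltonian. -/
theorem fderiv_fderiv_apply_of_hamiltonian {ζ : E → E [⋀^Fin 2]→L[ℝ] ℝ} {X Y : E → E}
    {f g : E → ℝ} {y : E}
    (hζ : DifferentiableAt ℝ ζ y) (hdζ : extDeriv ζ y = 0)
    (hX : DifferentiableAt ℝ X y) (hY : DifferentiableAt ℝ Y y)
    (hf : ContDiffAt ℝ 2 f y) (hg : ContDiffAt ℝ 2 g y)
    (hfX : ∀ᶠ z in 𝓝 y, ∀ w, fderiv ℝ f z w = -ζ z ![X z, w])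
    (hgY : ∀ᶠ z in 𝓝 y, ∀ w, fderiv ℝ g z w = -ζ z ![Y z, w]) (w : E) :
    fderiv ℝ (fun z => fderiv ℝ g z (X z)) y w = -ζ y ![lieBracket ℝ X Y y, w] := by
  have h0 : (fun z => fderiv ℝ g z (X z)) =ᶠ[𝓝 y] fun z => ζ z ![X z, Y z] := by
    filter_upwards [hgY] with z hz
    rw [hz, form_swap, neg_neg]
  rw [h0.fderiv_eq, fderiv_form_apply hζ hX hY, lieBracket, form_sub_left]
  -- Closedness of `X ⌟ ζ` on `(Y, w)`, of `Y ⌟ ζ` on `(X, w)`, and `dζ(X, Y, w) = 0` combine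
  -- linearly to the claim.
  have h1 := fderiv_contraction_symm hζ hX hf hfX (Y y) w
  have h2 := fderiv_contraction_symm hζ hY hg hgY (X y) w
  have h3 := extDeriv_two_apply hζ (X y) (Y y) w
  have h6 : extDeriv ζ y ![X y, Y y, w] = 0 := by rw [hdζ]; rfl
  have h4 := form_swap (ζ y) (X y) (fderiv ℝ Y y w)
  have h5 := form_swap (fderiv ℝ ζ y w) (X y) (Y y)
  linarith

theorem fderiv_lieBracket_apply {X Y : E → E} {f : E → ℝ} {y : E}
    (hX : DifferentiableAt ℝ X y) (hY : DifferentiableAt ℝ Y y) (hf : ContDiffAt ℝ 2 f y) :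
    fderiv ℝ f y (lieBracket ℝ X Y y) =
      fderiv ℝ (fun z => fderiv ℝ f z (Y z)) y (X y) -
        fderiv ℝ (fun z => fderiv ℝ f z (X z)) y (Y y) := by
  have hd : DifferentiableAt ℝ (fderiv ℝ f) y :=
    (hf.fderiv_right (m := 1) (by norm_num)).differentiableAt (by norm_num)
  rw [fderiv_clm_apply hd hY, fderiv_clm_apply hd hX, lieBracket, map_sub]
  have hs := (hf.isSymmSndFDerivAt (by simp)) (X y) (Y y)
  simp [hs]

end VectorSpace

/-! ### Functions, vector fields and Lie brackets read in the preferred chart at a point. -/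

section Chart

open VectorField Filter Topology Set

variable {N : ℕ} {P : Type*} [TopologicalSpace P] [ChartedSpace (EuclideanSpace ℝ (Fin N)) P]

/-- The representation of a vector field in the chart at `x₀`. -/
def fieldInChart (X : (x : P) → TangentSpace (𝓡 N) x) (x₀ : P) :
    EuclideanSpace ℝ (Fin N) → EuclideanSpace ℝ (Fin N) :=
  mpullbackWithin 𝓘(ℝ, EuclideanSpace ℝ (Fin N)) (𝓡 N) (extChartAt (𝓡 N) x₀).symm X
    (range (𝓡 N))

theorem formInChart_apply {k : ℕ} (η : (x : P) → (TangentSpace (𝓡 N) x) [⋀^Fin k]→L[ℝ] ℝ)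
    (x₀ : P) (y : EuclideanSpace ℝ (Fin N)) (v : Fin k → EuclideanSpace ℝ (Fin N)) :
    formInChart η x₀ y v = η ((extChartAt (𝓡 N) x₀).symm y) (fun i =>
      mfderiv 𝓘(ℝ, EuclideanSpace ℝ (Fin N)) (𝓡 N) (extChartAt (𝓡 N) x₀).symm y (v i)) :=
  rfl

variable [IsManifold (𝓡 N) ∞ P]

theorem mdifferentiableAt_extChartAt_symm' {x₀ : P} {y : EuclideanSpace ℝ (Fin N)}
    (hy : y ∈ (extChartAt (𝓡 N) x₀).target) :
    MDifferentiableAt 𝓘(ℝ, EuclideanSpace ℝ (Fin N)) (𝓡 N) (extChartAt (𝓡 N) x₀).symm y := by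
  have : IsManifold (𝓡 N) 1 P := IsManifold.of_le (n := ∞) (by simp)
  have h := mdifferentiableWithinAt_extChartAt_symm hy
  rwa [ModelWithCorners.range_eq_univ, mdifferentiableWithinAt_univ] at h

theorem fderiv_comp_extChartAt_symm {f : P → ℝ} {x₀ : P} {y : EuclideanSpace ℝ (Fin N)}
    (hy : y ∈ (extChartAt (𝓡 N) x₀).target)
    (hf : MDifferentiableAt (𝓡 N) 𝓘(ℝ, ℝ) f ((extChartAt (𝓡 N) x₀).symm y))
    (w : EuclideanSpace ℝ (Fin N)) :
    fderiv ℝ (f ∘ (extChartAt (𝓡 N) x₀).symm) y w =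
      mvfderiv (𝓡 N) f ((extChartAt (𝓡 N) x₀).symm y)
        (mfderiv 𝓘(ℝ, EuclideanSpace ℝ (Fin N)) (𝓡 N) (extChartAt (𝓡 N) x₀).symm y w) := by
  have h := mvfderiv_comp_apply y hf (mdifferentiableAt_extChartAt_symm' hy) w
  rw [mvfderiv, mfderiv_eq_fderiv] at h
  exact h

theorem mfderiv_extChartAt_symm_fieldInChart (X : (x : P) → TangentSpace (𝓡 N) x) {x₀ : P}
    {y : EuclideanSpace ℝ (Fin N)} (hy : y ∈ (extChartAt (𝓡 N) x₀).target) :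
    mfderiv 𝓘(ℝ, EuclideanSpace ℝ (Fin N)) (𝓡 N) (extChartAt (𝓡 N) x₀).symm y
      (fieldInChart X x₀ y) = X ((extChartAt (𝓡 N) x₀).symm y) := by
  have : IsManifold (𝓡 N) 1 P := IsManifold.of_le (n := ∞) (by simp)
  have h := isInvertible_mfderivWithin_extChartAt_symm hy
  have h2 := h.self_apply_inverse (X ((extChartAt (𝓡 N) x₀).symm y))
  rw [fieldInChart, mpullbackWithin_apply]
  rw [ModelWithCorners.range_eq_univ, mfderivWithin_univ] at *
  exact h2

/-- The tangent space at `x₀` is the model space, identified through the preferred chart at `x₀`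
itself; hence tangent vectors at the centre need no conversion. -/
theorem mfderiv_extChartAt_symm_self (x₀ : P) (v : EuclideanSpace ℝ (Fin N)) :
    (mfderiv 𝓘(ℝ, EuclideanSpace ℝ (Fin N)) (𝓡 N) (extChartAt (𝓡 N) x₀).symm
      (extChartAt (𝓡 N) x₀ x₀) v : EuclideanSpace ℝ (Fin N)) = v := by
  have : IsManifold (𝓡 N) 1 P := IsManifold.of_le (n := ∞) (by simp)
  have h := mfderivWithin_range_extChartAt_symm (I := 𝓡 N) (x := x₀)
  rw [ModelWithCorners.range_eq_univ, mfderivWithin_univ] at h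
  rw [h]
  rfl

/-- The manifold bracket is computed in this very chart and pulled back by its differential, which
is the identity at `x₀`. -/
theorem mlieBracket_eq_lieBracket_fieldInChart (X Y : (x : P) → TangentSpace (𝓡 N) x) (x₀ : P) :
    mlieBracket (𝓡 N) X Y x₀ =
      lieBracket ℝ (fieldInChart X x₀) (fieldInChart Y x₀) (extChartAt (𝓡 N) x₀ x₀) := by
  have : IsManifold (𝓡 N) 1 P := IsManifold.of_le (n := ∞) (by simp)
  have h (v : EuclideanSpace ℝ (Fin N)) :
      ((mfderiv (𝓡 N) 𝓘(ℝ, EuclideanSpace ℝ (Fin N)) (extChartAt (𝓡 N) x₀) x₀).inverse v :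
        EuclideanSpace ℝ (Fin N)) = v := by
    rw [mfderiv_extChartAt_self]
    exact congrArg (fun L : EuclideanSpace ℝ (Fin N) →L[ℝ] EuclideanSpace ℝ (Fin N) => L v)
      ContinuousLinearMap.inverse_id
  rw [mlieBracket, mlieBracketWithin_apply]
  refine (h _).trans ?_
  rw [← lieBracketWithin_univ, ModelWithCorners.range_eq_univ, preimage_univ, inter_univ]
  simp only [fieldInChart, ModelWithCorners.range_eq_univ]
  rfl

theorem differentiableAt_fieldInChart {X : (x : P) → TangentSpace (𝓡 N) x} {x₀ : P}
    (hX : MDifferentiableAt (𝓡 N) (𝓡 N).tangent (fun x => (⟨x, X x⟩ : TangentBundle (𝓡 N) P)) x₀) :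
    DifferentiableAt ℝ (fieldInChart X x₀) (extChartAt (𝓡 N) x₀ x₀) := by
  have : IsManifold (𝓡 N) 2 P := IsManifold.of_le (n := ∞) (by norm_cast)
  have h := (mdifferentiableWithinAt_univ.2 hX).differentiableWithinAt_mpullbackWithin_vectorField
  rw [preimage_univ, univ_inter] at h
  change DifferentiableWithinAt ℝ (fieldInChart X x₀) _ _ at h
  rwa [ModelWithCorners.range_eq_univ, differentiableWithinAt_univ] at h

theorem contDiffAt_comp_extChartAt_symm {f : P → ℝ} (hf : ContMDiff (𝓡 N) 𝓘(ℝ, ℝ) ∞ f) (x₀ : P) :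
    ContDiffAt ℝ 2 (f ∘ (extChartAt (𝓡 N) x₀).symm) (extChartAt (𝓡 N) x₀ x₀) := by
  have h1 := contMDiffOn_extChartAt_symm (I := 𝓡 N) (n := ∞) x₀
  have h2 := (hf.comp_contMDiffOn h1).contDiffOn
  have h3 := h2.contDiffAt (x := extChartAt (𝓡 N) x₀ x₀)
    ((isOpen_extChartAt_target x₀).mem_nhds (mem_extChartAt_target x₀))
  exact h3.of_le (by norm_cast)

end Chart

/-! ### Smooth vector fields and the Hamiltonian calculus of a single closed 2-form on `P`. -/

section Fields

open VectorField Filter Topology Set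

variable (N : ℕ) (P : Type*) [TopologicalSpace P] [ChartedSpace (EuclideanSpace ℝ (Fin N)) P]

/-- Smooth real functions on `P`. -/
abbrev SmoothFunction : Type _ := C^∞⟮𝓡 N, P; ℝ⟯

/-- Smooth vector fields on `P`. -/
abbrev SmoothField [IsManifold (𝓡 N) ∞ P] : Type _ :=
  Cₛ^∞⟮𝓡 N; EuclideanSpace ℝ (Fin N), (TangentSpace (𝓡 N) : P → Type _)⟯

variable {N P}

theorem mvfderiv_smoothFunction_add (f g : SmoothFunction N P) (x : P)
    (v : TangentSpace (𝓡 N) x) :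
    mvfderiv (𝓡 N) (⇑(f + g)) x v = mvfderiv (𝓡 N) f x v + mvfderiv (𝓡 N) g x v := by
  rw [ContMDiffMap.coe_add, mvfderiv_add f.mdifferentiableAt g.mdifferentiableAt, add_apply]

theorem mvfderiv_smoothFunction_mul (f g : SmoothFunction N P) (x : P)
    (v : TangentSpace (𝓡 N) x) :
    mvfderiv (𝓡 N) (⇑(f * g)) x v =
      f x * mvfderiv (𝓡 N) g x v + g x * mvfderiv (𝓡 N) f x v := by
  rw [ContMDiffMap.coe_mul, mvfderiv_mul f.mdifferentiableAt g.mdifferentiableAt, add_apply]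
  rfl

theorem mvfderiv_smoothFunction_smul (c : ℝ) (g : SmoothFunction N P) (x : P)
    (v : TangentSpace (𝓡 N) x) :
    mvfderiv (𝓡 N) (⇑(c • g)) x v = c * mvfderiv (𝓡 N) g x v := by
  have h := const_smul_mfderiv (I := 𝓡 N) (g.mdifferentiableAt (x := x)) c
  exact congrArg (fun L => L v) h

/-- The differential of smooth functions at a point, in the direction of a tangent vector. -/
def dirDeriv (x : P) (v : TangentSpace (𝓡 N) x) : SmoothFunction N P →ₗ[ℝ] ℝ where
  toFun f := mvfderiv (𝓡 N) f x v
  map_add' f g := mvfderiv_smoothFunction_add f g x v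
  map_smul' c f := mvfderiv_smoothFunction_smul c f x v

variable [IsManifold (𝓡 N) ∞ P]

theorem contMDiff_mvfderiv_apply (X : SmoothField N P) (g : SmoothFunction N P) :
    ContMDiff (𝓡 N) 𝓘(ℝ, ℝ) ∞ fun x => mvfderiv (𝓡 N) g x (X x) := by
  have h1 : ContMDiff (𝓡 N).tangent 𝓘(ℝ, ℝ).tangent ∞ (tangentMap (𝓡 N) 𝓘(ℝ, ℝ) g) :=
    g.contMDiff.contMDiff_tangentMap (by simp)
  exact ((contMDiff_snd_tangentBundle_modelSpace ℝ 𝓘(ℝ, ℝ)).comp h1).comp X.contMDiff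

/-- The derivative `X(g)` of a smooth function along a smooth vector field. -/
def lieDeriv : SmoothField N P →ₗ[ℝ] SmoothFunction N P →ₗ[ℝ] SmoothFunction N P :=
  LinearMap.mk₂ ℝ (fun X g => ⟨fun x => mvfderiv (𝓡 N) g x (X x), contMDiff_mvfderiv_apply X g⟩)
    (fun X Y g => by ext x; exact map_add (mvfderiv (𝓡 N) g x) (X x) (Y x))
    (fun c X g => by ext x; exact map_smul (mvfderiv (𝓡 N) g x) c (X x))
    (fun X f g => by ext x; exact mvfderiv_smoothFunction_add f g x (X x))
    (fun c X g => by ext x; exact mvfderiv_smoothFunction_smul c g x (X x))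

theorem lieDeriv_apply (X : SmoothField N P) (g : SmoothFunction N P) (x : P) :
    lieDeriv X g x = mvfderiv (𝓡 N) g x (X x) :=
  rfl

theorem lieDeriv_mul (X : SmoothField N P) (f g : SmoothFunction N P) :
    lieDeriv X (f * g) = lieDeriv X f * g + f * lieDeriv X g := by
  ext x
  refine (mvfderiv_smoothFunction_mul f g x (X x)).trans ?_
  simp only [lieDeriv_apply, ContMDiffMap.coe_add, ContMDiffMap.coe_mul, Pi.add_apply,
    Pi.mul_apply]
  ring

/-- The product of a smooth function and a smooth vector field. -/
def fieldSMul : SmoothFunction N P →ₗ[ℝ] SmoothField N P →ₗ[ℝ] SmoothField N P :=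
  LinearMap.mk₂ ℝ (fun f X => ⟨fun x => f x • X x, f.contMDiff.smul_section X.contMDiff⟩)
    (fun f g X => by ext1 x; exact add_smul (f x) (g x) (X x))
    (fun c f X => by ext1 x; exact mul_smul c (f x) (X x))
    (fun f X Y => by ext1 x; exact smul_add (f x) (X x) (Y x))
    (fun c f X => by ext1 x; exact smul_comm (f x) c (X x))

/-- The Lie bracket of smooth vector fields. -/
def fieldBracket : SmoothField N P →ₗ[ℝ] SmoothField N P →ₗ[ℝ] SmoothField N P :=
  haveI : IsManifold (𝓡 N) (minSmoothness ℝ 2) P :=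
    IsManifold.of_le (n := ∞) (by simpa using by norm_cast)
  LinearMap.mk₂ ℝ (fun X Y => ⟨mlieBracket (𝓡 N) X Y,
      haveI : IsManifold (𝓡 N) ((⊤ : ℕ∞) + 1) P := by simpa
      ContDiff.mlieBracket_vectorField (m := ⊤) (n := ⊤) X.contMDiff Y.contMDiff (by simp)⟩)
    (fun X Y Z => by
      ext1 x; exact mlieBracket_add_left X.mdifferentiableAt Y.mdifferentiableAt)
    (fun c X Y => by ext1 x; exact mlieBracket_const_smul_left X.mdifferentiableAt)
    (fun X Y Z => by
      ext1 x; exact mlieBracket_add_right Y.mdifferentiableAt Z.mdifferentiableAt)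
    (fun c X Y => by ext1 x; exact mlieBracket_const_smul_right Y.mdifferentiableAt)

theorem fieldBracket_apply (X Y : SmoothField N P) (x : P) :
    fieldBracket X Y x = mlieBracket (𝓡 N) X Y x :=
  rfl

/-- Stated on a neighbourhood and not only at the centre, because `X(g)` is going to be
differentiated once more. -/
theorem eventually_lieDeriv_comp_extChartAt_symm (X : SmoothField N P) (g : SmoothFunction N P)
    (x₀ : P) :
    (lieDeriv X g) ∘ (extChartAt (𝓡 N) x₀).symm =ᶠ[𝓝 (extChartAt (𝓡 N) x₀ x₀)]
      fun y => fderiv ℝ (g ∘ (extChartAt (𝓡 N) x₀).symm) y (fieldInChart X x₀ y) := by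
  filter_upwards [(isOpen_extChartAt_target x₀).mem_nhds (mem_extChartAt_target x₀)] with y hy
  rw [fderiv_comp_extChartAt_symm hy g.mdifferentiableAt,
    mfderiv_extChartAt_symm_fieldInChart _ hy]
  rfl

theorem mvfderiv_eq_fderiv_comp_extChartAt_symm (g : SmoothFunction N P) (x₀ : P)
    (v : TangentSpace (𝓡 N) x₀) :
    mvfderiv (𝓡 N) g x₀ v =
      fderiv ℝ (g ∘ (extChartAt (𝓡 N) x₀).symm) (extChartAt (𝓡 N) x₀ x₀) v := by
  have h := fderiv_comp_extChartAt_symm (mem_extChartAt_target x₀)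
    (g.mdifferentiableAt (x := (extChartAt (𝓡 N) x₀).symm (extChartAt (𝓡 N) x₀ x₀))) v
  -- The chart inverse returns `x₀` only up to a propositional equality, on which the type of the
  -- tangent vector depends; taking `u` in the model space avoids a transport.
  have key : ∀ p, p = x₀ → ∀ u : EuclideanSpace ℝ (Fin N),
      mvfderiv (𝓡 N) g p u = mvfderiv (𝓡 N) g x₀ u := by
    rintro p rfl u
    rfl
  refine (key _ (extChartAt_to_inv (I := 𝓡 N) x₀) v).symm.trans (Eq.trans ?_ h.symm)
  exact congrArg (fun u : EuclideanSpace ℝ (Fin N) => mvfderiv (𝓡 N) g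
    ((extChartAt (𝓡 N) x₀).symm (extChartAt (𝓡 N) x₀ x₀)) u) (mfderiv_extChartAt_symm_self x₀ v).symm

theorem fieldInChart_self (X : SmoothField N P) (x₀ : P) :
    fieldInChart X x₀ (extChartAt (𝓡 N) x₀ x₀) = X x₀ := by
  have h := mfderiv_extChartAt_symm_fieldInChart X (mem_extChartAt_target (I := 𝓡 N) x₀)
  have h2 := mfderiv_extChartAt_symm_self x₀ (fieldInChart X x₀ (extChartAt (𝓡 N) x₀ x₀))
  refine (h2.symm.trans h).trans ?_
  rw [extChartAt_to_inv]

theorem lieDeriv_fieldBracket (X Y : SmoothField N P) (f : SmoothFunction N P) :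
    lieDeriv (fieldBracket X Y) f = lieDeriv X (lieDeriv Y f) - lieDeriv Y (lieDeriv X f) := by
  ext x
  have h := fderiv_lieBracket_apply (differentiableAt_fieldInChart (X.mdifferentiableAt (x := x)))
    (differentiableAt_fieldInChart (Y.mdifferentiableAt (x := x)))
    (contDiffAt_comp_extChartAt_symm f.contMDiff x)
  rw [← (eventually_lieDeriv_comp_extChartAt_symm X f x).fderiv_eq,
    ← (eventually_lieDeriv_comp_extChartAt_symm Y f x).fderiv_eq,
    fieldInChart_self, fieldInChart_self] at h
  simp only [ContMDiffMap.coe_sub, Pi.sub_apply]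
  simp only [lieDeriv_apply]
  rw [mvfderiv_eq_fderiv_comp_extChartAt_symm, mvfderiv_eq_fderiv_comp_extChartAt_symm,
    mvfderiv_eq_fderiv_comp_extChartAt_symm, fieldBracket_apply,
    mlieBracket_eq_lieBracket_fieldInChart]
  exact h

/-- `X` is a Hamiltonian vector field of `f` for the 2-form `η`: `df = -X ⌟ η`. -/
def IsHamiltonianField (η : (x : P) → (TangentSpace (𝓡 N) x) [⋀^Fin 2]→L[ℝ] ℝ)
    (X : SmoothField N P) (f : SmoothFunction N P) : Prop :=
  ∀ (x : P) (w : TangentSpace (𝓡 N) x), mvfderiv (𝓡 N) f x w = -η x ![X x, w]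

namespace IsHamiltonianField

variable {η : (x : P) → (TangentSpace (𝓡 N) x) [⋀^Fin 2]→L[ℝ] ℝ} {X Y : SmoothField N P}
  {f g : SmoothFunction N P}

theorem zero : IsHamiltonianField η 0 0 := fun x w => by
  have h1 : mvfderiv (𝓡 N) (⇑(0 : SmoothFunction N P)) x w = 0 := (dirDeriv x w).map_zero
  have h2 : η x ![(0 : SmoothField N P) x, w] = 0 := form_zero_left (η x) w
  rw [h1, h2, neg_zero]

theorem add (hX : IsHamiltonianField η X f) (hY : IsHamiltonianField η Y g) :
    IsHamiltonianField η (X + Y) (f + g) := fun x w => by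
  have h : η x ![(X + Y) x, w] = _ := form_add_left (η x) (X x) (Y x) w
  rw [mvfderiv_smoothFunction_add, hX, hY, h]
  ring

/-- Both sides are `η(X, Y)`. Antisymmetry of the bracket and its independence of the chosen fields
both come from here. -/
theorem lieDeriv_eq (hX : IsHamiltonianField η X f) (hY : IsHamiltonianField η Y g) :
    lieDeriv X g = -lieDeriv Y f := by
  ext x
  change mvfderiv (𝓡 N) g x (X x) = -mvfderiv (𝓡 N) f x (Y x)
  rw [hX, hY, form_swap]

theorem mul (hX : IsHamiltonianField η X f) (hY : IsHamiltonianField η Y g) :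
    IsHamiltonianField η (fieldSMul g X + fieldSMul f Y) (f * g) := fun x w => by
  have h : η x ![(fieldSMul g X + fieldSMul f Y) x, w] = _ :=
    form_add_left (η x) (g x • X x) (f x • Y x) w
  rw [mvfderiv_smoothFunction_mul, h, form_smul_left, form_smul_left, hX, hY]
  ring

theorem eventually_chart (hX : IsHamiltonianField η X f) (x₀ : P) :
    ∀ᶠ y in 𝓝 (extChartAt (𝓡 N) x₀ x₀), ∀ w,
      fderiv ℝ (f ∘ (extChartAt (𝓡 N) x₀).symm) y w =
        -formInChart η x₀ y ![fieldInChart X x₀ y, w] := by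
  filter_upwards [(isOpen_extChartAt_target x₀).mem_nhds (mem_extChartAt_target x₀)] with y hy w
  rw [fderiv_comp_extChartAt_symm hy f.mdifferentiableAt, hX, formInChart_apply,
    ← mfderiv_extChartAt_symm_fieldInChart X hy]
  congr 2
  ext1 i
  fin_cases i <;> rfl

/-- The vector space statement `fderiv_fderiv_apply_of_hamiltonian`, applied at the centre of the
chart at each point. -/
theorem bracket (hη : IsSmoothForm η) (hdη : IsClosedForm η) (hX : IsHamiltonianField η X f)
    (hY : IsHamiltonianField η Y g) :
    IsHamiltonianField η (fieldBracket X Y) (lieDeriv X g) := fun x w => by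
  have hd : DifferentiableAt ℝ (formInChart η x) (extChartAt (𝓡 N) x x) :=
    ((hη x).contDiffAt ((isOpen_extChartAt_target x).mem_nhds
      (mem_extChartAt_target x))).differentiableAt (by simp)
  have h := fderiv_fderiv_apply_of_hamiltonian hd (hdη x _ (mem_extChartAt_target x))
    (differentiableAt_fieldInChart (X.mdifferentiableAt (x := x)))
    (differentiableAt_fieldInChart (Y.mdifferentiableAt (x := x)))
    (contDiffAt_comp_extChartAt_symm f.contMDiff x)
    (contDiffAt_comp_extChartAt_symm g.contMDiff x)
    (hX.eventually_chart x) (hY.eventually_chart x) w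
  rw [← (eventually_lieDeriv_comp_extChartAt_symm X g x).fderiv_eq,
    ← mlieBracket_eq_lieBracket_fieldInChart] at h
  rw [mvfderiv_eq_fderiv_comp_extChartAt_symm, h, formInChart_apply, fieldBracket_apply]
  have e : (fun i => mfderiv 𝓘(ℝ, EuclideanSpace ℝ (Fin N)) (𝓡 N) (extChartAt (𝓡 N) x).symm
      (extChartAt (𝓡 N) x x) ((![mlieBracket (𝓡 N) X Y x, w] :
        Fin 2 → EuclideanSpace ℝ (Fin N)) i) : Fin 2 → EuclideanSpace ℝ (Fin N)) =
      ![mlieBracket (𝓡 N) X Y x, w] := by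
    ext1 i
    exact mfderiv_extChartAt_symm_self x _
  rw [extChartAt_to_inv] at *
  congr 1
  exact congrArg (η x) e

end IsHamiltonianField

end Fields

/-! ### Symmetric tensors as homogeneous polynomials. -/

section Contraction

variable {n : ℕ} {V W U : Type*} [AddCommGroup V] [Module ℝ V] [AddCommGroup W] [Module ℝ W]
  [AddCommGroup U] [Module ℝ U]

/-- The complete contraction of a family `T^{α₁ … α_m}` with the covector `ξ`, that is, the value
at `ξ` of the homogeneous polynomial `∑ T^{α₁ … α_m} ξ_{α₁} … ξ_{α_m}`. -/
def contract (ξ : Fin n → ℝ) (m : ℕ) : (MultiIndex n m → V) →ₗ[ℝ] V :=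
  ∑ α, (∏ i, ξ (α i)) • LinearMap.proj α

theorem contract_apply (ξ : Fin n → ℝ) {m : ℕ} (T : MultiIndex n m → V) :
    contract ξ m T = ∑ α, (∏ i, ξ (α i)) • T α := by
  simp [contract]

theorem contract_map (ξ : Fin n → ℝ) {m : ℕ} (L : V →ₗ[ℝ] W) (T : MultiIndex n m → V) :
    contract ξ m (fun α => L (T α)) = L (contract ξ m T) := by
  simp [contract_apply]

theorem symmetrize_map {m : ℕ} (L : V →ₗ[ℝ] W) (T : MultiIndex n m → V) (α : MultiIndex n m) :
    symmetrize (fun β => L (T β)) α = L (symmetrize T α) := by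
  simp [symmetrize]

theorem contract_smul_covector (t : ℝ) (ξ : Fin n → ℝ) {m : ℕ} (T : MultiIndex n m → V) :
    contract (t • ξ) m T = t ^ m • contract ξ m T := by
  simp [contract_apply, Finset.prod_mul_distrib, Finset.smul_sum, mul_smul]

theorem contract_comp_perm (ξ : Fin n → ℝ) {m : ℕ} (T : MultiIndex n m → V)
    (σ : Equiv.Perm (Fin m)) : contract ξ m (fun α => T (α ∘ σ)) = contract ξ m T := by
  rw [contract_apply, contract_apply]
  refine Fintype.sum_equiv (Equiv.arrowCongr σ.symm (Equiv.refl _)) _ _ fun α => ?_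
  have h : (Equiv.arrowCongr σ.symm (Equiv.refl (Fin n))) α = α ∘ σ := by
    ext i
    simp
  rw [h, ← Equiv.prod_comp σ]
  rfl

/-- The weight `∏ ξ_{α_i}` is invariant under permutations of the indices, so all `m!` terms of the
average contract to the same value. -/
theorem contract_symmetrize (ξ : Fin n → ℝ) {m : ℕ} (T : MultiIndex n m → V) :
    contract ξ m (symmetrize T) = contract ξ m T := by
  have h : (symmetrize T : MultiIndex n m → V) =
      ((m.factorial : ℝ)⁻¹) • ∑ σ : Equiv.Perm (Fin m), fun α => T (α ∘ σ) := by
    ext α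
    simp [symmetrize]
  rw [h, map_smul, map_sum]
  simp only [contract_comp_perm]
  rw [Finset.sum_const, Finset.card_univ, Fintype.card_perm, Fintype.card_fin,
    ← Nat.cast_smul_eq_nsmul ℝ, smul_smul, inv_mul_cancel₀ (by positivity), one_smul]

/-- The weight of a concatenated multi-index is the product of the two weights. Used with `B` the
product of functions, the product of a function and a field, the derivative along a field, and the
Lie bracket. -/
theorem contract_append (ξ : Fin n → ℝ) {p q : ℕ} (B : V →ₗ[ℝ] W →ₗ[ℝ] U)
    (S : MultiIndex n p → V) (T : MultiIndex n q → W) :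
    contract ξ (p + q) (fun β : MultiIndex n (p + q) =>
      B (S fun i => β (Fin.castAdd q i)) (T fun j => β (Fin.natAdd p j)))
      = B (contract ξ p S) (contract ξ q T) := by
  simp only [contract_apply]
  rw [← (Fin.appendEquiv p q).sum_comp, Fintype.sum_prod_type]
  simp only [map_sum, map_smul, LinearMap.sum_apply, LinearMap.smul_apply, Finset.smul_sum,
    smul_smul]
  rw [Finset.sum_comm]
  refine Finset.sum_congr rfl fun β _ => Finset.sum_congr rfl fun α _ => ?_
  rw [mul_comm]
  simp [Fin.appendEquiv, Fin.prod_univ_add]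

theorem contract_last (ξ : Fin n → ℝ) {k : ℕ} (B : V →ₗ[ℝ] W →ₗ[ℝ] U)
    (S : MultiIndex n k → V) (T : Fin n → W) :
    contract ξ (k + 1) (fun β : MultiIndex n (k + 1) => B (S fun i => β i.castSucc) (T (β (Fin.last k))))
      = B (contract ξ k S) (∑ γ, ξ γ • T γ) := by
  have h := contract_append ξ B S (fun β : MultiIndex n 1 => T (β 0))
  have h2 : contract ξ 1 (fun β : MultiIndex n 1 => T (β 0)) = ∑ γ, ξ γ • T γ := by
    rw [contract_apply]
    refine Fintype.sum_equiv (Equiv.funUnique (Fin 1) (Fin n)) _ _ fun α => ?_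
    simp
  rw [← h2, ← h]
  rfl

theorem contract_cast (ξ : Fin n → ℝ) {m m' : ℕ} (h : m = m') (T : MultiIndex n m → V) :
    contract ξ m' (fun β => T fun i => β (Fin.cast h i)) = contract ξ m T := by
  subst h
  rfl

theorem isSymm_symmetrize {m : ℕ} (T : MultiIndex n m → V) :
    IsSymm (symmetrize T : MultiIndex n m → V) := by
  intro σ α
  simp only [symmetrize]
  congr 1
  exact Fintype.sum_equiv (Equiv.mulLeft σ) _ _ fun τ => rfl

/-- Equal exponent vectors mean that `α` and `β` take each value equally often; bijections between
the fibres glue to a permutation. -/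
theorem exists_perm_of_sum_single_eq {m : ℕ} {α β : MultiIndex n m}
    (h : ∑ i, Finsupp.single (α i) 1 = ∑ i, (Finsupp.single (β i) 1 : Fin n →₀ ℕ)) :
    ∃ σ : Equiv.Perm (Fin m), α = β ∘ σ := by
  have hc : ∀ c, Fintype.card {i // α i = c} = Fintype.card {i // β i = c} := by
    intro c
    have := DFunLike.congr_fun h c
    simpa [Finsupp.finsetSum_apply, Finsupp.single_apply, Fintype.card_subtype] using this
  let e := (Equiv.sigmaFiberEquiv α).symm.trans
    ((Equiv.sigmaCongrRight fun c => Fintype.equivOfCardEq (hc c)).trans (Equiv.sigmaFiberEquiv β))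
  refine ⟨e, ?_⟩
  funext i
  exact (Fintype.equivOfCardEq (hc (α i)) ⟨i, rfl⟩).2.symm

/-- A real polynomial that vanishes everywhere is zero, and the coefficient at the monomial of `α`
is `T α` times the number of rearrangements of `α`. -/
theorem IsSymm.eq_zero_of_contract {m : ℕ} {T : MultiIndex n m → ℝ} (hT : IsSymm T)
    (h : ∀ ξ, contract ξ m T = 0) : T = 0 := by
  classical
  let p : MvPolynomial (Fin n) ℝ :=
    ∑ α, MvPolynomial.monomial (∑ i, Finsupp.single (α i) 1) (T α)
  have hp : p = 0 := by
    refine MvPolynomial.funext fun ξ => ?_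
    have := h ξ
    rw [contract_apply] at this
    simp only [p, map_sum, MvPolynomial.eval_monomial, map_zero]
    rw [← this]
    refine Finset.sum_congr rfl fun α _ => ?_
    rw [← Finsupp.prod_finsetSum_index (by simp) (by simp [pow_add])]
    simp [mul_comm]
  ext α
  have hc : p.coeff (∑ i, Finsupp.single (α i) 1) = 0 := by rw [hp]; simp
  simp only [p, MvPolynomial.coeff_sum, MvPolynomial.coeff_monomial] at hc
  have hs : ∀ β : MultiIndex n m,
      (if ∑ i, Finsupp.single (β i) 1 = ∑ i, (Finsupp.single (α i) 1 : Fin n →₀ ℕ)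
        then T β else 0) =
      (if ∑ i, Finsupp.single (β i) 1 = ∑ i, (Finsupp.single (α i) 1 : Fin n →₀ ℕ)
        then 1 else 0) * T α := by
    intro β
    split_ifs with hb
    · obtain ⟨σ, rfl⟩ := exists_perm_of_sum_single_eq hb
      rw [hT, one_mul]
    · simp
  simp only [hs, ← Finset.sum_mul, mul_eq_zero] at hc
  -- The number of rearrangements is positive, as `α` itself is counted.
  refine hc.resolve_left (ne_of_gt ?_)
  refine Finset.sum_pos' (fun β _ => by split_ifs <;> norm_num) ⟨α, Finset.mem_univ _, by simp⟩

theorem IsSymm.ext_contract {m : ℕ} {S T : MultiIndex n m → ℝ} (hS : IsSymm S) (hT : IsSymm T)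
    (h : ∀ ξ, contract ξ m S = contract ξ m T) : S = T := by
  refine sub_eq_zero.1 (IsSymm.eq_zero_of_contract (fun σ α => ?_) fun ξ => ?_)
  · simp [hS σ α, hT σ α]
  · rw [map_sub, h, sub_self]

end Contraction

/-! ### Reduction of the tensorial Hamiltonian equation to the scalar forms `ω_ξ`; closure of `SHF`.
-/

section ContractedForm

variable {N n : ℕ} {P : Type*} [TopologicalSpace P] [ChartedSpace (EuclideanSpace ℝ (Fin N)) P]

theorem IsSmoothForm.zero {k : ℕ} :
    IsSmoothForm (0 : (x : P) → (TangentSpace (𝓡 N) x) [⋀^Fin k]→L[ℝ] ℝ) := fun _ =>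
  contDiffOn_const (c := 0)

theorem IsSmoothForm.add {k : ℕ} {η θ : (x : P) → (TangentSpace (𝓡 N) x) [⋀^Fin k]→L[ℝ] ℝ}
    (hη : IsSmoothForm η) (hθ : IsSmoothForm θ) : IsSmoothForm (η + θ) := fun x₀ =>
  (hη x₀).add (hθ x₀)

theorem IsSmoothForm.const_smul {k : ℕ} {η : (x : P) → (TangentSpace (𝓡 N) x) [⋀^Fin k]→L[ℝ] ℝ}
    (c : ℝ) (hη : IsSmoothForm η) : IsSmoothForm (c • η) := fun x₀ =>
  (hη x₀).const_smul c

theorem IsSmoothForm.differentiableAt {k : ℕ}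
    {η : (x : P) → (TangentSpace (𝓡 N) x) [⋀^Fin k]→L[ℝ] ℝ} (hη : IsSmoothForm η) {x₀ : P}
    {y : EuclideanSpace ℝ (Fin N)} (hy : y ∈ (extChartAt (𝓡 N) x₀).target) :
    DifferentiableAt ℝ (formInChart η x₀) y :=
  ((hη x₀).contDiffAt ((isOpen_extChartAt_target x₀).mem_nhds hy)).differentiableAt (by simp)

theorem IsClosedForm.zero {k : ℕ} :
    IsClosedForm (0 : (x : P) → (TangentSpace (𝓡 N) x) [⋀^Fin k]→L[ℝ] ℝ) := fun x₀ y _ => by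
  have h := extDeriv_smul (0 : ℝ)
    (formInChart (0 : (x : P) → (TangentSpace (𝓡 N) x) [⋀^Fin k]→L[ℝ] ℝ) x₀) (x := y)
  rw [zero_smul, zero_smul] at h
  exact h

theorem IsClosedForm.add {k : ℕ} {η θ : (x : P) → (TangentSpace (𝓡 N) x) [⋀^Fin k]→L[ℝ] ℝ}
    (hη : IsClosedForm η) (hθ : IsClosedForm θ) (sη : IsSmoothForm η) (sθ : IsSmoothForm θ) :
    IsClosedForm (η + θ) := fun x₀ y hy => by
  have h := extDeriv_add (sη.differentiableAt hy) (sθ.differentiableAt hy)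
  rw [hη x₀ y hy, hθ x₀ y hy, add_zero] at h
  exact h

theorem IsClosedForm.const_smul {k : ℕ} {η : (x : P) → (TangentSpace (𝓡 N) x) [⋀^Fin k]→L[ℝ] ℝ}
    (c : ℝ) (hη : IsClosedForm η) : IsClosedForm (c • η) := fun x₀ y hy => by
  have h := extDeriv_smul c (formInChart η x₀) (x := y)
  rw [hη x₀ y hy, smul_zero] at h
  exact h

/-- The scalar 2-form `∑ ξ_γ ω^γ`. -/
def GeneralNSymplecticStructure.contractedForm (Ω : GeneralNSymplecticStructure N n P)
    (ξ : Fin n → ℝ) : (x : P) → (TangentSpace (𝓡 N) x) [⋀^Fin 2]→L[ℝ] ℝ :=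
  ∑ γ, ξ γ • Ω.form γ

theorem contractedForm_smooth_closed (Ω : GeneralNSymplecticStructure N n P) (ξ : Fin n → ℝ) :
    IsSmoothForm (Ω.contractedForm ξ) ∧ IsClosedForm (Ω.contractedForm ξ) := by
  refine Finset.sum_induction _
    (fun η : (x : P) → (TangentSpace (𝓡 N) x) [⋀^Fin 2]→L[ℝ] ℝ => IsSmoothForm η ∧ IsClosedForm η)
    (fun η θ hη hθ => ⟨hη.1.add hθ.1, hη.2.add hθ.2 hη.1 hθ.1⟩) ⟨.zero, .zero⟩
    fun γ _ => ⟨(Ω.smooth γ).const_smul _, (Ω.closed γ).const_smul _⟩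

/-- The value of smooth functions at a point. -/
def evalAt (x : P) : SmoothFunction N P →ₗ[ℝ] ℝ where
  toFun f := f x
  map_add' _ _ := rfl
  map_smul' _ _ := rfl

theorem IsSymm.tensorFunction_ext {m : ℕ} {f g : TensorFunction N n P m} (hf : IsSymm f)
    (hg : IsSymm g) (h : ∀ ξ, contract ξ m f = contract ξ m g) : f = g := by
  ext α x
  refine congrFun (IsSymm.ext_contract (S := fun α => f α x) (T := fun α => g α x)
    (fun σ β => ?_) (fun σ β => ?_) fun ξ => ?_) α
  · simp only [hf σ β]
  · simp only [hg σ β]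
  · exact (contract_map ξ (evalAt x) f).trans
      ((congrArg (evalAt x) (h ξ)).trans (contract_map ξ (evalAt x) g).symm)

theorem contract_symProduct (ξ : Fin n → ℝ) {p q : ℕ} (f : TensorFunction N n P p)
    (g : TensorFunction N n P q) :
    contract ξ (p + q) (symProduct f g) = contract ξ p f * contract ξ q g :=
  (contract_symmetrize ξ _).trans (contract_append ξ (LinearMap.mul ℝ (SmoothFunction N P)) f g)

theorem isSymm_symProduct {p q : ℕ} (f : TensorFunction N n P p) (g : TensorFunction N n P q) :
    IsSymm (symProduct f g) :=
  isSymm_symmetrize _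

variable [IsManifold (𝓡 N) ∞ P]

/-- The value `η(X(x), w)` as a bilinear function of the 2-covector `η` at `x` and the vector
field `X`. -/
def pairing (x : P) (w : TangentSpace (𝓡 N) x) :
    SmoothField N P →ₗ[ℝ] ((TangentSpace (𝓡 N) x) [⋀^Fin 2]→L[ℝ] ℝ) →ₗ[ℝ] ℝ :=
  LinearMap.mk₂ ℝ (fun X η => η ![X x, w])
    (fun X Y η => form_add_left η (X x) (Y x) w)
    (fun c X η => form_smul_left η c (X x) w)
    (fun _ _ _ => rfl)
    (fun _ _ _ => rfl)

/-- Both sides of the defining equation are symmetric in the indices, so it may be tested on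
contractions; there the index `α_{k+1}` turns `ω` into `ω_ξ`, and the factorial is absorbed into the
field. -/
theorem isHamiltonianFor_iff (Ω : GeneralNSymplecticStructure N n P) {k : ℕ}
    {f : TensorFunction N n P (k + 1)} (hf : IsSymm f) (X : TensorVectorField N n P k) :
    IsHamiltonianFor Ω f X ↔ ∀ ξ, IsHamiltonianField (Ω.contractedForm ξ)
      (((k + 1).factorial : ℝ) • contract ξ k X) (contract ξ (k + 1) f) := by
  have h1 : ∀ ξ x w, contract ξ (k + 1) (fun α => mvfderiv (𝓡 N) (f α) x w) =
      mvfderiv (𝓡 N) (contract ξ (k + 1) f : SmoothFunction N P) x w := fun ξ x w =>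
    contract_map ξ (dirDeriv x w) f
  have h2 : ∀ ξ (x : P) (w : TangentSpace (𝓡 N) x), contract ξ (k + 1)
      (fun α => -((k + 1).factorial : ℝ) * symmetrize (fun β : MultiIndex n (k + 1) =>
          Ω.form (β (Fin.last k)) x ![X (fun i => β i.castSucc) x, w]) α) =
      -Ω.contractedForm ξ x ![(((k + 1).factorial : ℝ) • contract ξ k X) x, w] := by
    intro ξ x w
    have h3 := contract_map ξ (LinearMap.lsmul ℝ ℝ (-((k + 1).factorial : ℝ)))
      (symmetrize (fun β : MultiIndex n (k + 1) =>
          Ω.form (β (Fin.last k)) x ![X (fun i => β i.castSucc) x, w]))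
    rw [contract_symmetrize] at h3
    have h4 := contract_last ξ (pairing x w) X (fun γ => Ω.form γ x)
    have h5 : Ω.contractedForm ξ x = ∑ γ, ξ γ • Ω.form γ x := by
      simp [GeneralNSymplecticStructure.contractedForm]
    refine h3.trans ?_
    rw [h5]
    refine (congrArg (fun r : ℝ => -((k + 1).factorial : ℝ) * r) h4).trans ?_
    have h6 := (pairing x w).map_smul₂ ((k + 1).factorial : ℝ) (contract ξ k X)
      (∑ γ, ξ γ • Ω.form γ x)
    rw [neg_mul]
    exact congrArg Neg.neg h6.symm
  constructor
  · intro H ξ x w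
    rw [← h1, ← h2]
    exact congrArg _ (funext fun α => H α x w)
  · intro H α x w
    refine congrFun (IsSymm.ext_contract (S := fun α => mvfderiv (𝓡 N) (f α) x w)
      (T := fun α => -((k + 1).factorial : ℝ) * symmetrize (fun β : MultiIndex n (k + 1) =>
          Ω.form (β (Fin.last k)) x ![X (fun i => β i.castSucc) x, w]) α)
      (fun σ β => ?_) (fun σ β => ?_) fun ξ => ?_) α
    · simp only [hf σ β]
    · simp only [isSymm_symmetrize _ σ β]
    · rw [h1, h2]
      exact H ξ x w

theorem symProduct_mem_SHF {Ω : GeneralNSymplecticStructure N n P} {k l : ℕ}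
    {f : TensorFunction N n P (k + 1)} {g : TensorFunction N n P (l + 1)} (hf : f ∈ SHF Ω k)
    (hg : g ∈ SHF Ω l) : symProduct f g ∈ SHF Ω (k + 1 + l) := by
  obtain ⟨sf, X, hX⟩ := hf
  obtain ⟨sg, Y, hY⟩ := hg
  rw [isHamiltonianFor_iff Ω sf] at hX
  rw [isHamiltonianFor_iff Ω sg] at hY
  let c : ℝ := ((k + 1 + l + 1).factorial : ℝ)
  have hc : c ≠ 0 := by positivity
  let Z₁ : TensorVectorField N n P (k + 1 + l) := fun β =>
    fieldSMul (f fun i => β (Fin.castAdd l i)) (Y fun j => β (Fin.natAdd (k + 1) j))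
  let Z₂ : TensorVectorField N n P (l + 1 + k) := fun β =>
    fieldSMul (g fun i => β (Fin.castAdd k i)) (X fun j => β (Fin.natAdd (l + 1) j))
  -- Chosen so that its contraction, times the factorial `c` of the total rank, is the field `gX +
  -- fY` of the product `fg`. The cast reconciles `l + 1 + k` with `k + 1 + l`.
  let Z : TensorVectorField N n P (k + 1 + l) :=
    c⁻¹ • (((k + 1).factorial : ℝ) • (fun β => Z₂ fun i => β (Fin.cast (by omega) i)) +
      ((l + 1).factorial : ℝ) • Z₁)
  refine ⟨isSymm_symProduct f g, Z, (isHamiltonianFor_iff Ω (isSymm_symProduct f g) Z).2 fun ξ => ?_⟩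
  have h1 : contract ξ _ Z₁ = fieldSMul (contract ξ _ f) (contract ξ _ Y) :=
    contract_append ξ fieldSMul f Y
  have h2 : contract ξ _ Z₂ = fieldSMul (contract ξ _ g) (contract ξ _ X) :=
    contract_append ξ fieldSMul g X
  have h3 : c • contract ξ _ Z =
      fieldSMul (contract ξ _ g) (((k + 1).factorial : ℝ) • contract ξ _ X) +
      fieldSMul (contract ξ _ f) (((l + 1).factorial : ℝ) • contract ξ _ Y) := by
    simp only [Z, map_smul, map_add, contract_cast, h1, h2]
    rw [smul_smul, mul_inv_cancel₀ hc, one_smul]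
  have h4 := (hX ξ).mul (hY ξ)
  rw [← h3, ← contract_symProduct] at h4
  exact h4

/-- The bracket of a family with Hamiltonian vector fields `X` and the family `g`. -/
def bracketFunction {k l : ℕ} (X : TensorVectorField N n P k) (g : TensorFunction N n P (l + 1)) :
    TensorFunction N n P (k + l + 1) :=
  ((k + 1).factorial : ℝ) • symmetrize (fun β : MultiIndex n (k + (l + 1)) =>
    lieDeriv (X fun i => β (Fin.castAdd (l + 1) i)) (g fun j => β (Fin.natAdd k j)))

theorem bracketFunction_apply {k l : ℕ} (X : TensorVectorField N n P k)
    (g : TensorFunction N n P (l + 1)) (α : MultiIndex n (k + l + 1)) (x : P) :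
    bracketFunction X g α x = bracketComponent X g α x := by
  have h := symmetrize_map (evalAt x) (fun β : MultiIndex n (k + (l + 1)) =>
    lieDeriv (X fun i => β (Fin.castAdd (l + 1) i)) (g fun j => β (Fin.natAdd k j))) α
  exact (congrArg (fun r : ℝ => ((k + 1).factorial : ℝ) * r) h).symm

theorem isSymm_bracketFunction {k l : ℕ} (X : TensorVectorField N n P k)
    (g : TensorFunction N n P (l + 1)) : IsSymm (bracketFunction X g) := fun σ α =>
  congrArg (fun h : SmoothFunction N P => ((k + 1).factorial : ℝ) • h) (isSymm_symmetrize _ σ α)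

theorem contract_bracketFunction (ξ : Fin n → ℝ) {k l : ℕ} (X : TensorVectorField N n P k)
    (g : TensorFunction N n P (l + 1)) :
    contract ξ (k + l + 1) (bracketFunction X g) =
      lieDeriv (((k + 1).factorial : ℝ) • contract ξ k X) (contract ξ (l + 1) g) := by
  rw [bracketFunction, map_smul, LinearMap.map_smul₂]
  exact congrArg _ ((contract_symmetrize ξ _).trans (contract_append ξ lieDeriv X g))

theorem bracketFunction_mem_SHF {Ω : GeneralNSymplecticStructure N n P} {k l : ℕ}
    {f : TensorFunction N n P (k + 1)} {g : TensorFunction N n P (l + 1)}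
    {X : TensorVectorField N n P k} (hf : IsSymm f) (hX : IsHamiltonianFor Ω f X)
    (hg : g ∈ SHF Ω l) : bracketFunction X g ∈ SHF Ω (k + l) := by
  obtain ⟨sg, Y, hY⟩ := hg
  rw [isHamiltonianFor_iff Ω hf] at hX
  rw [isHamiltonianFor_iff Ω sg] at hY
  let c : ℝ := ((k + l + 1).factorial : ℝ)
  have hc : c ≠ 0 := by positivity
  let W : TensorVectorField N n P (k + l) := fun β =>
    fieldBracket (X fun i => β (Fin.castAdd l i)) (Y fun j => β (Fin.natAdd k j))
  -- The constant trades the factorials carried by `X` and `Y` for the one required in rank `k + l +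
  -- 1`.
  let Z : TensorVectorField N n P (k + l) :=
    (c⁻¹ * (((k + 1).factorial : ℝ) * ((l + 1).factorial : ℝ))) • W
  refine ⟨isSymm_bracketFunction X g, Z,
    (isHamiltonianFor_iff Ω (isSymm_bracketFunction X g) Z).2 fun ξ => ?_⟩
  have h1 : contract ξ _ W = fieldBracket (contract ξ _ X) (contract ξ _ Y) :=
    contract_append ξ fieldBracket X Y
  have h3 : c • contract ξ _ Z = fieldBracket (((k + 1).factorial : ℝ) • contract ξ _ X)
      (((l + 1).factorial : ℝ) • contract ξ _ Y) := by
    simp only [Z, map_smul, LinearMap.smul_apply, h1, smul_smul]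
    rw [mul_inv_cancel_left₀ hc, mul_comm]
  have h4 := (hX ξ).bracket (contractedForm_smooth_closed Ω ξ).1
    (contractedForm_smooth_closed Ω ξ).2 (hY ξ)
  rw [← h3, ← contract_bracketFunction] at h4
  exact h4

end ContractedForm

/-! ### The operations on the direct sum and the Poisson identities. -/

section Total

variable {N n : ℕ} {P : Type*} [TopologicalSpace P] [ChartedSpace (EuclideanSpace ℝ (Fin N)) P]
  [IsManifold (𝓡 N) ∞ P] {Ω : GeneralNSymplecticStructure N n P}

theorem SHF_ext {k : ℕ} {f g : SHF Ω k}
    (h : ∀ ξ, contract ξ (k + 1) (f : TensorFunction N n P (k + 1)) =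
      contract ξ (k + 1) (g : TensorFunction N n P (k + 1))) : f = g :=
  Subtype.ext (IsSymm.tensorFunction_ext f.2.1 g.2.1 h)

local instance mulActionSHF {k : ℕ} : MulAction ℝ (SHF Ω k) := Module.toDistribMulAction.toMulAction

local instance smulCommClassSHF {k : ℕ} : SMulCommClass ℝ ℝ (SHF Ω k) := smulCommClass_self ℝ _

/-- The symmetrized tensor product of two homogeneous elements of `SHF`. -/
def homogeneousProductFun {k l : ℕ} (f : SHF Ω k) (g : SHF Ω l) : SHF Ω (k + 1 + l) :=
  ⟨(symProduct f.1 g.1 : TensorFunction N n P (k + 1 + (l + 1))), symProduct_mem_SHF f.2 g.2⟩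

theorem contract_homogeneousProductFun {k l : ℕ} (f : SHF Ω k) (g : SHF Ω l) (ξ : Fin n → ℝ) :
    contract ξ (k + 1 + l + 1) (homogeneousProductFun f g).1 =
      contract ξ (k + 1) f.1 * contract ξ (l + 1) g.1 :=
  contract_symProduct ξ f.1 g.1

variable (Ω) in
/-- The symmetrized tensor product on the homogeneous parts of `SHF`. -/
def homogeneousProduct (k l : ℕ) : SHF Ω k →ₗ[ℝ] SHF Ω l →ₗ[ℝ] SHF Ω (k + 1 + l) :=
  LinearMap.mk₂ ℝ homogeneousProductFun
    (fun f f' g => SHF_ext fun ξ => by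
      rw [Submodule.coe_add, map_add]
      simp only [contract_homogeneousProductFun, Submodule.coe_add, map_add, add_mul])
    (fun c f g => SHF_ext fun ξ => by
      rw [Submodule.coe_smul, map_smul]
      simp only [contract_homogeneousProductFun, Submodule.coe_smul, map_smul, smul_mul_assoc])
    (fun f g g' => SHF_ext fun ξ => by
      rw [Submodule.coe_add, map_add]
      simp only [contract_homogeneousProductFun, Submodule.coe_add, map_add, mul_add])
    (fun c f g => SHF_ext fun ξ => by
      rw [Submodule.coe_smul, map_smul]
      simp only [contract_homogeneousProductFun, Submodule.coe_smul, map_smul, mul_smul_comm])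

/-- A choice of Hamiltonian vector fields. -/
def hamiltonianFields {k : ℕ} (f : SHF Ω k) : TensorVectorField N n P k :=
  f.2.2.choose

theorem isHamiltonianFor_hamiltonianFields {k : ℕ} (f : SHF Ω k) :
    IsHamiltonianFor Ω f.1 (hamiltonianFields f) :=
  f.2.2.choose_spec

theorem IsHamiltonianFor.contract_bracketFunction_eq {k l : ℕ}
    {f : TensorFunction N n P (k + 1)} {g : TensorFunction N n P (l + 1)}
    {X : TensorVectorField N n P k} {Y : TensorVectorField N n P l} (hf : IsSymm f)
    (hg : IsSymm g) (hX : IsHamiltonianFor Ω f X) (hY : IsHamiltonianFor Ω g Y)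
    (ξ : Fin n → ℝ) :
    contract ξ (k + l + 1) (bracketFunction X g) =
      -lieDeriv (((l + 1).factorial : ℝ) • contract ξ l Y) (contract ξ (k + 1) f) := by
  rw [contract_bracketFunction]
  exact ((isHamiltonianFor_iff Ω hf X).1 hX ξ).lieDeriv_eq ((isHamiltonianFor_iff Ω hg Y).1 hY ξ)

/-- After contraction the bracket is `-Y(f)` for a Hamiltonian family `Y` of `g`, an expression in
which `X` does not occur. -/
theorem IsHamiltonianFor.bracketFunction_congr {k l : ℕ}
    {f : TensorFunction N n P (k + 1)} {g : TensorFunction N n P (l + 1)}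
    {X X' : TensorVectorField N n P k} (hf : IsSymm f) (hg : g ∈ SHF Ω l)
    (hX : IsHamiltonianFor Ω f X) (hX' : IsHamiltonianFor Ω f X') :
    bracketFunction X g = bracketFunction X' g := by
  obtain ⟨sg, Y, hY⟩ := hg
  refine IsSymm.tensorFunction_ext (isSymm_bracketFunction X g) (isSymm_bracketFunction X' g)
    fun ξ => ?_
  rw [hX.contract_bracketFunction_eq hf sg hY, hX'.contract_bracketFunction_eq hf sg hY]

/-- The bracket of two homogeneous elements of `SHF`. -/
def homogeneousBracketFun {k l : ℕ} (f : SHF Ω k) (g : SHF Ω l) : SHF Ω (k + l) :=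
  ⟨bracketFunction (hamiltonianFields f) g.1,
    bracketFunction_mem_SHF f.2.1 (isHamiltonianFor_hamiltonianFields f) g.2⟩

theorem contract_homogeneousBracketFun {k l : ℕ} (f : SHF Ω k) (g : SHF Ω l) (ξ : Fin n → ℝ) :
    contract ξ (k + l + 1) (homogeneousBracketFun f g).1 =
      lieDeriv (((k + 1).factorial : ℝ) • contract ξ k (hamiltonianFields f))
        (contract ξ (l + 1) g.1) :=
  contract_bracketFunction ξ _ _

theorem contract_homogeneousBracketFun' {k l : ℕ} (f : SHF Ω k) (g : SHF Ω l) (ξ : Fin n → ℝ) :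
    contract ξ (k + l + 1) (homogeneousBracketFun f g).1 =
      -lieDeriv (((l + 1).factorial : ℝ) • contract ξ l (hamiltonianFields g))
        (contract ξ (k + 1) f.1) :=
  (isHamiltonianFor_hamiltonianFields f).contract_bracketFunction_eq f.2.1 g.2.1
    (isHamiltonianFor_hamiltonianFields g) ξ

variable (Ω) in
/-- The bracket on the homogeneous parts of `SHF`. -/
def homogeneousBracket (k l : ℕ) : SHF Ω k →ₗ[ℝ] SHF Ω l →ₗ[ℝ] SHF Ω (k + l) :=
  LinearMap.mk₂ ℝ homogeneousBracketFun
    (fun f f' g => SHF_ext fun ξ => by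
      rw [Submodule.coe_add, map_add]
      -- The chosen fields need not depend linearly on `f`; the form `-Y(f)` of the bracket visibly
      -- does.
      simp only [contract_homogeneousBracketFun', Submodule.coe_add, map_add]
      rw [neg_add])
    (fun c f g => SHF_ext fun ξ => by
      rw [Submodule.coe_smul, map_smul]
      simp only [contract_homogeneousBracketFun', Submodule.coe_smul, map_smul]
      rw [smul_neg])
    (fun f g g' => SHF_ext fun ξ => by
      rw [Submodule.coe_add, map_add]
      simp only [contract_homogeneousBracketFun, Submodule.coe_add, map_add])
    (fun c f g => SHF_ext fun ξ => by
      rw [Submodule.coe_smul, map_smul]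
      simp only [contract_homogeneousBracketFun, Submodule.coe_smul, map_smul])

/-- The bilinear extension to `SHF` of operations on its homogeneous parts. -/
def bilinearExtension {d : ℕ → ℕ → ℕ}
    (B : ∀ k l, SHF Ω k →ₗ[ℝ] SHF Ω l →ₗ[ℝ] SHF Ω (d k l)) :
    TotalSHF Ω →ₗ[ℝ] TotalSHF Ω →ₗ[ℝ] TotalSHF Ω :=
  DirectSum.toModule ℝ ℕ _ fun k => LinearMap.flip (DirectSum.toModule ℝ ℕ _ fun l =>
    ((B k l).compr₂ (DirectSum.lof ℝ ℕ (fun k => SHF Ω k) (d k l))).flip)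

theorem bilinearExtension_of {d : ℕ → ℕ → ℕ}
    (B : ∀ k l, SHF Ω k →ₗ[ℝ] SHF Ω l →ₗ[ℝ] SHF Ω (d k l)) (k l : ℕ) (f : SHF Ω k)
    (g : SHF Ω l) :
    bilinearExtension B (DirectSum.of (fun k => SHF Ω k) k f)
      (DirectSum.of (fun k => SHF Ω k) l g) = DirectSum.of (fun k => SHF Ω k) (d k l) (B k l f g) := by
  simp only [bilinearExtension, ← DirectSum.lof_eq_of ℝ, DirectSum.toModule_lof,
    LinearMap.flip_apply, LinearMap.compr₂_apply]

variable (Ω) in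
/-- The sum over all ranks of the contractions with `ξ`. -/
def totalContract (ξ : Fin n → ℝ) : TotalSHF Ω →ₗ[ℝ] SmoothFunction N P :=
  DirectSum.toModule ℝ ℕ _ fun k => (contract ξ (k + 1)).comp (SHF Ω k).subtype

theorem totalContract_of (ξ : Fin n → ℝ) (k : ℕ) (f : SHF Ω k) :
    totalContract Ω ξ (DirectSum.of (fun k => SHF Ω k) k f) = contract ξ (k + 1) f.1 := by
  rw [totalContract, ← DirectSum.lof_eq_of ℝ, DirectSum.toModule_lof]
  rfl

open Classical in
theorem totalContract_smul_covector_apply (t : ℝ) (ξ : Fin n → ℝ) (a : TotalSHF Ω) (x : P) :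
    totalContract Ω (t • ξ) a x =
      ∑ k ∈ DFinsupp.support a, t ^ (k + 1) * contract ξ (k + 1) (a k).1 x := by
  conv_lhs => rw [← DirectSum.sum_support_of a]
  rw [map_sum]
  refine (map_sum (evalAt x) _ _).trans (Finset.sum_congr rfl fun k _ => ?_)
  rw [totalContract_of, contract_smul_covector]
  rfl

/-- At a fixed point of `P`, the contraction with `tξ` is a polynomial in `t` whose coefficient at
`t^(k+1)` comes from the component `a k` alone. -/
theorem total_eq_zero_of_totalContract {a : TotalSHF Ω} (h : ∀ ξ, totalContract Ω ξ a = 0) :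
    a = 0 := by
  classical
  refine DFinsupp.ext fun k => SHF_ext fun ξ => ?_
  ext x
  let p : Polynomial ℝ := ∑ k ∈ DFinsupp.support a,
    Polynomial.monomial (k + 1) (contract ξ (k + 1) (a k).1 x)
  have hp : p = 0 := Polynomial.funext fun t => by
    have h1 := totalContract_smul_covector_apply t ξ a x
    rw [h] at h1
    simp only [p, Polynomial.eval_finsetSum, Polynomial.eval_monomial, Polynomial.eval_zero]
    refine Eq.trans (Finset.sum_congr rfl fun j _ => mul_comm _ _) h1.symm
  have hc : p.coeff (k + 1) = 0 := by rw [hp, Polynomial.coeff_zero]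
  simp only [p, Polynomial.finsetSum_coeff, Polynomial.coeff_monomial, add_left_inj,
    Finset.sum_ite_eq'] at hc
  change contract ξ (k + 1) (a k).1 x = contract ξ (k + 1) (0 : TensorFunction N n P (k + 1)) x
  rw [map_zero]
  by_cases hk : k ∈ DFinsupp.support a
  · rw [if_pos hk] at hc
    exact hc
  · rw [DFinsupp.notMem_support_iff.1 hk]
    exact congrArg (fun f : SmoothFunction N P => f x) (map_zero (contract ξ (k + 1)))

theorem total_ext {a b : TotalSHF Ω} (h : ∀ ξ, totalContract Ω ξ a = totalContract Ω ξ b) :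
    a = b :=
  sub_eq_zero.1 (total_eq_zero_of_totalContract fun ξ => by rw [map_sub, h, sub_self])

variable (Ω) in
/-- The symmetrized tensor product on `SHF`. -/
def totalProduct : TotalSHF Ω →ₗ[ℝ] TotalSHF Ω →ₗ[ℝ] TotalSHF Ω :=
  bilinearExtension (homogeneousProduct Ω)

variable (Ω) in
/-- The bracket on `SHF`. -/
def totalBracket : TotalSHF Ω →ₗ[ℝ] TotalSHF Ω →ₗ[ℝ] TotalSHF Ω :=
  bilinearExtension (homogeneousBracket Ω)

theorem totalContract_totalProduct (ξ : Fin n → ℝ) (a b : TotalSHF Ω) :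
    totalContract Ω ξ (totalProduct Ω a b) = totalContract Ω ξ a * totalContract Ω ξ b := by
  induction a using DirectSum.induction_on with
  | zero => simp only [map_zero, LinearMap.zero_apply, zero_mul]
  | add a a' ha ha' => simp only [map_add, LinearMap.add_apply, ha, ha', add_mul]
  | of k f =>
    induction b using DirectSum.induction_on with
    | zero => simp only [map_zero, mul_zero]
    | add b b' hb hb' => simp only [map_add, hb, hb', mul_add]
    | of l g =>
      rw [totalProduct, bilinearExtension_of, totalContract_of, totalContract_of, totalContract_of]
      exact contract_symProduct ξ f.1 g.1

/-- For fixed `ξ` all ranks see the same form `ω_ξ`, so the fields of the homogeneous components add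
up. This reduces the Poisson identities for inhomogeneous elements to the calculus of a single
2-form. -/
theorem exists_hamiltonianField_totalContract (ξ : Fin n → ℝ) (a : TotalSHF Ω) :
    ∃ Z : SmoothField N P, IsHamiltonianField (Ω.contractedForm ξ) Z (totalContract Ω ξ a) ∧
      ∀ b, totalContract Ω ξ (totalBracket Ω a b) = lieDeriv Z (totalContract Ω ξ b) := by
  induction a using DirectSum.induction_on with
  | zero => exact ⟨0, by simpa only [map_zero] using .zero, fun b => by
      simp only [map_zero, LinearMap.zero_apply]⟩
  | add a a' ha ha' =>
    obtain ⟨Z, hZ, hb⟩ := ha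
    obtain ⟨Z', hZ', hb'⟩ := ha'
    exact ⟨Z + Z', by simpa only [map_add] using hZ.add hZ', fun b => by
      simp only [map_add, LinearMap.add_apply, hb, hb']⟩
  | of k f =>
    refine ⟨((k + 1).factorial : ℝ) • contract ξ k (hamiltonianFields f), ?_, fun b => ?_⟩
    · rw [totalContract_of]
      exact (isHamiltonianFor_iff Ω f.2.1 _).1 (isHamiltonianFor_hamiltonianFields f) ξ
    · induction b using DirectSum.induction_on with
      | zero => simp only [map_zero]
      | add b b' hb hb' => simp only [map_add, hb, hb']
      | of l g =>
        rw [totalBracket, bilinearExtension_of, totalContract_of, totalContract_of]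
        exact contract_homogeneousBracketFun f g ξ

theorem totalBracket_antisymm (a b : TotalSHF Ω) :
    totalBracket Ω a b = -totalBracket Ω b a := by
  refine total_ext fun ξ => ?_
  obtain ⟨Z, hZ, ha⟩ := exists_hamiltonianField_totalContract ξ a
  obtain ⟨Y, hY, hb⟩ := exists_hamiltonianField_totalContract ξ b
  rw [map_neg, ha, hb, hZ.lieDeriv_eq hY]

theorem totalBracket_jacobi (a b c : TotalSHF Ω) :
    totalBracket Ω a (totalBracket Ω b c) + totalBracket Ω b (totalBracket Ω c a) +
      totalBracket Ω c (totalBracket Ω a b) = 0 := by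
  refine total_ext fun ξ => ?_
  obtain ⟨X, hX, ha⟩ := exists_hamiltonianField_totalContract ξ a
  obtain ⟨Y, hY, hb⟩ := exists_hamiltonianField_totalContract ξ b
  obtain ⟨Z, hZ, hc⟩ := exists_hamiltonianField_totalContract ξ c
  have h1 := hX.bracket (contractedForm_smooth_closed Ω ξ).1 (contractedForm_smooth_closed Ω ξ).2 hY
  -- The third Jacobi term: `Z(X(b)) = -[X, Y](c) = -X(Y(c)) + Y(X(c))`. The second is `Y(Z(a)) =
  -- -Y(X(c))`, and the first is `X(Y(c))`.
  have h2 := hZ.lieDeriv_eq h1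
  rw [lieDeriv_fieldBracket] at h2
  simp only [map_add, map_zero, ha, hb, hc]
  rw [h2, hZ.lieDeriv_eq hX, map_neg]
  abel

theorem isPoissonAlgebra_total : IsPoissonAlgebra (A := TotalSHF Ω) (totalProduct Ω) (totalBracket Ω) where
  mul_comm a b := total_ext fun ξ => by simp only [totalContract_totalProduct, mul_comm]
  mul_assoc a b c := total_ext fun ξ => by simp only [totalContract_totalProduct, mul_assoc]
  bracket_self a := total_ext fun ξ => by
    have h := congrArg (totalContract Ω ξ) (totalBracket_antisymm a a)
    rw [map_neg] at h
    rw [map_zero]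
    ext x
    -- A real number equal to its own negative is zero.
    exact self_eq_neg.1 (congrArg (evalAt x) h)
  bracket_antisymm := totalBracket_antisymm
  jacobi := totalBracket_jacobi
  leibniz a b c := total_ext fun ξ => by
    obtain ⟨X, -, ha⟩ := exists_hamiltonianField_totalContract ξ a
    simp only [map_add, totalContract_totalProduct, ha, lieDeriv_mul]

end Total

end NSymplectic

end

open NSymplectic in
theorem mainTheorem9 (N n : ℕ) (P : Type*) [TopologicalSpace P]
    [ChartedSpace (EuclideanSpace ℝ (Fin N)) P] [IsManifold (𝓡 N) ∞ P]
    (Ω : GeneralNSymplecticStructure N n P) :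
    ∃ mul br : TotalSHF Ω →ₗ[ℝ] TotalSHF Ω →ₗ[ℝ] TotalSHF Ω,
      (∀ (k l : ℕ) (f : SHF Ω k) (g : SHF Ω l),
        ∃ h : SHF Ω (k + 1 + l),
          (h : TensorFunction N n P (k + 1 + l + 1)) =
            symProduct (f : TensorFunction N n P (k + 1)) (g : TensorFunction N n P (l + 1)) ∧
          mul (DirectSum.of (fun k => SHF Ω k) k f) (DirectSum.of (fun k => SHF Ω k) l g) =
            DirectSum.of (fun k => SHF Ω k) (k + 1 + l) h) ∧
      (∀ (k l : ℕ) (f : SHF Ω k) (g : SHF Ω l),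
        ∃ h : SHF Ω (k + l),
          (∀ X : TensorVectorField N n P k,
            IsHamiltonianFor Ω (f : TensorFunction N n P (k + 1)) X →
              ∀ (α : MultiIndex n (k + l + 1)) (x : P),
                (h : TensorFunction N n P (k + l + 1)) α x =
                  bracketComponent X (g : TensorFunction N n P (l + 1)) α x) ∧
          br (DirectSum.of (fun k => SHF Ω k) k f) (DirectSum.of (fun k => SHF Ω k) l g) =
            DirectSum.of (fun k => SHF Ω k) (k + l) h) ∧
      IsPoissonAlgebra (A := TotalSHF Ω) mul br := by
  refine ⟨totalProduct Ω, totalBracket Ω, fun k l f g => ⟨homogeneousProduct Ω k l f g, rfl,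
    bilinearExtension_of _ k l f g⟩, fun k l f g => ⟨homogeneousBracket Ω k l f g,
    fun X hX α x => ?_, bilinearExtension_of _ k l f g⟩, isPoissonAlgebra_total⟩
  -- The element `h` is built from one choice of fields; any other choice `X` yields the same
  -- components.
  rw [← bracketFunction_apply, ← (isHamiltonianFor_hamiltonianFields f).bracketFunction_congr
    f.2.1 g.2 hX]
  rfl
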